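/- Let $q>2$ be a prime power and let $V$ be a $3$-dimensional vector space over $\mathbb{F}_{q^3}$. Then $V$ is a $9$-dimensional vector space over $\mathbb{F}_q$; write $\mathrm{PG}(2,q^3)$ and $\mathrm{PG}(8,q)$ for the projective spaces of $V$ over $\mathbb{F}_{q^3}$ and over $\mathbb{F}_q$. Each point $\bar P$ of $\mathrm{PG}(2,q^3)$ is a $1$-dimensional $\mathbb{F}_{q^3}$-subspace of $V$, hence a $3$-dimensional $\mathbb{F}_q$-subspace, and so defines a plane $[\![P]\!]$ of $\mathrm{PG}(8,q)$; these planes form the regular (Desarguesian) $2$-spread $\mathbb{S}$ of $\mathrm{PG}(8,q)$. Let $\phi$ be a collineation of $\mathrm{PG}(2,q^3)$ of order $3$ that fixes an $\mathbb{F}_q$-plane (a set of points consisting, for some basis of $V$, of all points with homogeneous coordinates in $\mathbb{F}_q$) pointwise, and let $\sigma\in\mathrm{PGL}(9,q)$ be a projectivity of $\mathrm{PG}(8,q)$ that induces $\phi$ on $\mathbb{S}$, that is, $\sigma$ maps $[\![P]\!]$ onto $[\![P^{\phi}]\!]$ for every point $\bar P$. An $\mathbb{S}_{\mathrm{III}}$-plane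 is a plane $[\![P]\!]$ for which $\bar P,\bar P^{\phi},\bar P^{\phi^2}$ are not collinear. A fixed-III-plane is a plane $\pi$ of $\mathrm{PG}(8,q)$ with $\pi^\sigma=\pi$ that contains a point $Q$ lying on some $\mathbb{S}_{\mathrm{III}}$-plane such that $Q,Q^\sigma,Q^{\sigma^2}$ are not collinear. Let $\gamma$ be an $\mathbb{S}_{\mathrm{III}}$-plane. Then there are exactly $q^2+q+1$ fixed-III-planes that meet $\gamma$, they are pairwise disjoint, and the set of all of them is one of the two systems of ruling planes of a Segre variety $\mathcal{S}_{2;2}$ of $\mathrm{PG}(8,q)$. (Here a Segre variety $\mathcal{S}_{2;2}$ is the set of points with homogeneous coordinates $(x_iy_j)_{0\le i,j\le 2}$ with respect to some basis of $V$ over $\mathbb{F}_q$, with $x,y\in\mathbb{F}_q^3\setminus\{0\}$; its two systems of ruling planes are obtained by fixing $x$ and letting $y$ vary, and by fixing $y$ and letting $x$ vary.) -/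

import Mathlib

/-!
Subspaces of a projective space are represented by their sets of points. For a cubic extension
`K / F` of finite fields, `|F| = q`, and a `K`-vector space `V` of dimension 3, the projective
plane `ℙ K V` is `PG(2, q³)` and the projective space `ℙ F V` is `PG(8, q)`.
-/

open scoped LinearAlgebra.Projectivization

namespace FieldReduction

section Projective

variable {k V : Type*} [Field k] [AddCommGroup V] [Module k V]

/-- The set of points of `PG(V)` that lie in a given vector subspace. -/
def pointSet (W : Submodule k V) : Set (ℙ k V) := {P | P.submodule ≤ W}

/-- A line of `PG(V)`, as a set of points. -/
def IsLine (X : Set (ℙ k V)) : Prop :=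
  ∃ W : Submodule k V, Module.finrank k W = 2 ∧ X = pointSet W

/-- A plane of `PG(V)`, as a set of points. -/
def IsPlane (X : Set (ℙ k V)) : Prop :=
  ∃ W : Submodule k V, Module.finrank k W = 3 ∧ X = pointSet W

/-- Three (not necessarily distinct) points lie on a common line. -/
def AreCollinear (P Q R : ℙ k V) : Prop :=
  ∃ X : Set (ℙ k V), IsLine X ∧ P ∈ X ∧ Q ∈ X ∧ R ∈ X

/-- A collineation: a permutation of the points that maps the lines onto the lines. -/
def IsCollineation (φ : Equiv.Perm (ℙ k V)) : Prop :=
  ∀ X : Set (ℙ k V), IsLine (φ '' X) ↔ IsLine X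

/-- A projectivity: a permutation of the points given by an invertible linear map. -/
def IsProjectivity (σ : Equiv.Perm (ℙ k V)) : Prop :=
  ∃ s : V ≃ₗ[k] V, ∀ P : ℙ k V, σ P = Projectivization.map s.toLinearMap s.injective P

/-- A point has Type III for `φ` if `P`, `φ P`, `φ² P` are three non-collinear points. -/
def IsTypeIII (φ : Equiv.Perm (ℙ k V)) (P : ℙ k V) : Prop :=
  ¬ AreCollinear P (φ P) (φ (φ P))

end Projective

section Segre

variable {F V : Type*} [Field F] [AddCommGroup V] [Module F V]

/-- The vector with coordinates `x i * y j` with respect to the basis `b`. -/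
noncomputable def segreVector (b : Module.Basis (Fin 3 × Fin 3) F V) (x y : Fin 3 → F) : V :=
  ∑ i, ∑ j, (x i * y j) • b (i, j)

/-- The Segre variety `S_{2;2}` with respect to the coordinates given by `b`. -/
def segreVariety (b : Module.Basis (Fin 3 × Fin 3) F V) : Set (ℙ F V) :=
  {P | ∃ x y : Fin 3 → F, x ≠ 0 ∧ y ≠ 0 ∧ P.submodule = Submodule.span F {segreVector b x y}}

/-- The first system of ruling planes: in each of them `x` is fixed and `y` varies. -/
def firstRulingSystem (b : Module.Basis (Fin 3 × Fin 3) F V) : Set (Set (ℙ F V)) :=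
  {X | ∃ x : Fin 3 → F, x ≠ 0 ∧
    X = {P | ∃ y : Fin 3 → F, y ≠ 0 ∧ P.submodule = Submodule.span F {segreVector b x y}}}

/-- The second system of ruling planes: in each of them `y` is fixed and `x` varies. -/
def secondRulingSystem (b : Module.Basis (Fin 3 × Fin 3) F V) : Set (Set (ℙ F V)) :=
  {X | ∃ y : Fin 3 → F, y ≠ 0 ∧
    X = {P | ∃ x : Fin 3 → F, x ≠ 0 ∧ P.submodule = Submodule.span F {segreVector b x y}}}

/-- `𝒮` is a Segre variety `S_{2;2}` of `PG(V)`, and `𝔾` is one of its two systems of ruling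
planes. -/
def IsRulingSystemOfSegre (𝒮 : Set (ℙ F V)) (𝔾 : Set (Set (ℙ F V))) : Prop :=
  ∃ b : Module.Basis (Fin 3 × Fin 3) F V,
    𝒮 = segreVariety b ∧ (𝔾 = firstRulingSystem b ∨ 𝔾 = secondRulingSystem b)

end Segre

section Bose

variable (F : Type*) {K V : Type*} [Field F] [Field K] [Algebra F K]
  [AddCommGroup V] [Module K V] [Module F V] [IsScalarTower F K V]

/-- An `F`-plane of `ℙ K V`: the points with coordinates in `F`, for some basis of `V`. -/
def IsSubplane (B : Set (ℙ K V)) : Prop :=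
  ∃ b : Module.Basis (Fin 3) K V,
    B = {P | ∃ a : Fin 3 → F, a ≠ 0 ∧ P.submodule = Submodule.span K {∑ i, a i • b i}}

/-- The spread element of `ℙ F V` that corresponds to the point `P` of `ℙ K V`: the one-dimensional
`K`-subspace `P`, viewed as an `F`-subspace. -/
def spreadPlane (P : ℙ K V) : Set (ℙ F V) :=
  pointSet (P.submodule.restrictScalars F)

/-- `σ`, acting on the spread, is `φ`. -/
def Induces (φ : Equiv.Perm (ℙ K V)) (σ : Equiv.Perm (ℙ F V)) : Prop :=
  ∀ P : ℙ K V, σ '' spreadPlane F P = spreadPlane F (φ P)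

/-- A spread plane that corresponds to a point of Type III. -/
def IsSpreadIIIPlane (φ : Equiv.Perm (ℙ K V)) (γ : Set (ℙ F V)) : Prop :=
  ∃ P : ℙ K V, IsTypeIII φ P ∧ γ = spreadPlane F P

/-- A III-point of `ℙ F V`: a point on a spread plane of Type III. -/
def IsIIIPoint (φ : Equiv.Perm (ℙ K V)) (Q : ℙ F V) : Prop :=
  ∃ γ : Set (ℙ F V), IsSpreadIIIPlane F φ γ ∧ Q ∈ γ

/-- A fixed-III-plane: a plane of `ℙ F V` that is fixed (as a set) by `σ` and contains a point `Q`
which is a III-point and forms a triangle with its images under `σ`. -/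
def IsFixedIIIPlane (φ : Equiv.Perm (ℙ K V)) (σ : Equiv.Perm (ℙ F V))
    (π : Set (ℙ F V)) : Prop :=
  IsPlane π ∧ σ '' π = π ∧
    ∃ Q ∈ π, IsIIIPoint F φ Q ∧ ¬ AreCollinear Q (σ Q) (σ (σ Q))

/-- The set of all fixed-III-planes that meet `γ`. -/
def fixedIIIPlanesMeeting (φ : Equiv.Perm (ℙ K V)) (σ : Equiv.Perm (ℙ F V))
    (γ : Set (ℙ F V)) : Set (Set (ℙ F V)) :=
  {π | IsFixedIIIPlane F φ σ π ∧ (π ∩ γ).Nonempty}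

end Bose

end FieldReduction

namespace FieldReduction

/-! ### Collinearity and linear independence -/

section Projective

variable {k V : Type*} [Field k] [AddCommGroup V] [Module k V]

/-! The projectivity `σ` lifts to an `F`-linear bijection `s` that permutes the `K`-lines of `V`.
Fixing a subplane pointwise forces `s` to be semilinear for some `θ` in `Gal(K/F)`
(`exists_algHom_of_fixes_subplane`). As `φ ≠ 1`, `θ` has order 3 and `s³` is a scalar `d` in `F`, a
norm from `K` (`exists_semilinear_of_induces`).

If `u` spans a Type III point, then `u`, `s u`, `s² u` is a `K`-basis of `V`. A fixed plane through
the point of `x • u` contains the orbit of `x • u`, whose `F`-span already has dimension 3. So the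
planes sought are exactly these spans (`fixedIIIPlanesMeeting_eq`), with vectors `y₀x • u + y₁θ(x) •
s u + y₂θ²(x) • s² u`. This expression is `F`-bilinear in `x` and `y` and identifies `K ⊗ F³` with
`V`, which gives the Segre variety. A nonzero such vector determines `x` up to `F`, so the planes
are disjoint and correspond to the points of `ℙ F K`. -/

lemma mk_mem_pointSet {W : Submodule k V} {v : V} (hv : v ≠ 0) :
    Projectivization.mk k v hv ∈ pointSet W ↔ v ∈ W := by
  simp [pointSet, Submodule.span_singleton_le_iff_mem]

lemma pointSet_injective : Function.Injective (pointSet : Submodule k V → Set (ℙ k V)) := by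
  intro W W' h
  ext v
  by_cases hv : v = 0
  · simp [hv]
  · rw [← mk_mem_pointSet hv, ← mk_mem_pointSet hv, h]

lemma not_areCollinear_of_linearIndependent {u v w : V} (hu : u ≠ 0) (hv : v ≠ 0) (hw : w ≠ 0)
    (h : LinearIndependent k ![u, v, w]) :
    ¬ AreCollinear (Projectivization.mk k u hu) (Projectivization.mk k v hv)
      (Projectivization.mk k w hw) := by
  rintro ⟨_, ⟨W, hW, rfl⟩, h0, h1, h2⟩
  rw [mk_mem_pointSet] at h0 h1 h2
  have : Module.Finite k W := Module.finite_of_finrank_pos (by omega)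
  have hle : Submodule.span k (Set.range ![u, v, w]) ≤ W := by
    rw [Submodule.span_le]
    rintro _ ⟨i, rfl⟩
    fin_cases i <;> assumption
  have := Submodule.finrank_mono hle
  rw [finrank_span_eq_card h, hW] at this
  simp at this

lemma linearIndependent_of_not_areCollinear (hV : Module.finrank k V = 3) {u v w : V}
    (hu : u ≠ 0) (hv : v ≠ 0) (hw : w ≠ 0)
    (h : ¬ AreCollinear (Projectivization.mk k u hu) (Projectivization.mk k v hv)
      (Projectivization.mk k w hw)) : LinearIndependent k ![u, v, w] := by
  have : Module.Finite k V := Module.finite_of_finrank_pos (by omega)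
  rw [linearIndependent_iff_card_le_finrank_span]
  by_contra hlt
  rw [Set.finrank, Fintype.card_fin, not_le] at hlt
  have hlt' : Submodule.span k (Set.range ![u, v, w]) < ⊤ := by
    rw [lt_top_iff_ne_top]
    intro h'
    rw [h', finrank_top, hV] at hlt
    omega
  -- The kernel of a nonzero functional has dimension exactly 2, even when the three vectors span
  -- less.
  obtain ⟨f, hf, hle⟩ := Submodule.exists_le_ker_of_lt_top _ hlt'
  have hmem (i : Fin 3) : ![u, v, w] i ∈ LinearMap.ker f :=
    hle (Submodule.subset_span (Set.mem_range_self i))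
  refine h ⟨_, ⟨LinearMap.ker f, ?_, rfl⟩, (mk_mem_pointSet hu).2 (hmem 0),
    (mk_mem_pointSet hv).2 (hmem 1), (mk_mem_pointSet hw).2 (hmem 2)⟩
  have h1 := LinearMap.finrank_range_add_finrank_ker f
  rw [LinearMap.range_eq_top.2 (LinearMap.surjective hf), finrank_top, Module.finrank_self] at h1
  omega

lemma coeff_eq_of_linearIndependent {u v w : V} (hli : LinearIndependent k ![u, v, w])
    {x y z x' y' z' : k} (h : x • u + y • v + z • w = x' • u + y' • v + z' • w) :
    x = x' ∧ y = y' ∧ z = z' := by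
  have h0 : (x - x') • u + (y - y') • v + (z - z') • w = 0 := by
    rw [← sub_eq_zero] at h
    rw [← h]
    module
  have := Fintype.linearIndependent_iff.1 hli ![x - x', y - y', z - z']
    (by simpa [Fin.sum_univ_three] using h0)
  exact ⟨sub_eq_zero.1 (this 0), sub_eq_zero.1 (this 1), sub_eq_zero.1 (this 2)⟩

end Projective

/-! ### Semilinearity and the cubic Galois group -/

section Semilinear

variable {F K V : Type*} [Field F] [Field K] [Algebra F K]
  [AddCommGroup V] [Module K V] [Module F V] [IsScalarTower F K V]

/-- An `F`-linear bijection that maps `K`-lines to `K`-lines and fixes the points with coordinates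
in `F` is semilinear over `K`. -/
lemma exists_algHom_of_fixes_subplane (b : Module.Basis (Fin 3) K V) (s : V ≃ₗ[F] V)
    (hs : ∀ v : V, v ≠ 0 → ∀ c : K, ∃ d : K, s (c • v) = d • s v)
    (hb : ∀ a : Fin 3 → F, a ≠ 0 → ∃ c : K, s (∑ i, a i • b i) = c • ∑ i, a i • b i) :
    ∃ (θ : K →ₐ[F] K) (c : K), (∀ i, s (b i) = c • b i) ∧
      ∀ (x : K) (v : V), s (x • v) = θ x • s v := by
  have hrel {x y z x' y' z' : K} (h : x • b 0 + y • b 1 + z • b 2 =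
      x' • b 0 + y' • b 1 + z' • b 2) : x = x' ∧ y = y' ∧ z = z' := by
    refine coeff_eq_of_linearIndependent ?_ h
    convert b.linearIndependent using 1
    ext i
    fin_cases i <;> rfl
  have hone (i : Fin 3) : ∃ c : K, s (b i) = c • b i := by
    have := hb (Pi.single i 1) (by simp)
    simpa [Pi.single_apply, ite_smul] using this
  choose e he using hone
  -- The fixed unit point forces the three multipliers `e i` to coincide.
  obtain ⟨c, hc⟩ := hb 1 one_ne_zero
  have hc' : s (b 0 + b 1 + b 2) = c • (b 0 + b 1 + b 2) := by
    simpa [Fin.sum_univ_three] using hc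
  have hec (i : Fin 3) : e i = c := by
    have h : e 0 • b 0 + e 1 • b 1 + e 2 • b 2 = c • b 0 + c • b 1 + c • b 2 := by
      rw [← he, ← he, ← he, ← map_add, ← map_add, hc', smul_add, smul_add]
    obtain ⟨h0, h1, h2⟩ := hrel h
    fin_cases i <;> assumption
  have hsb (i : Fin 3) : s (b i) = c • b i := by rw [he, hec]
  have hc0 : c ≠ 0 := by
    rintro rfl
    have := hsb 0
    rw [zero_smul, LinearEquiv.map_eq_zero_iff] at this
    exact b.ne_zero 0 this
  have hex (i : Fin 3) (x : K) : ∃ y : K, s (x • b i) = y • b i := by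
    obtain ⟨d, hd⟩ := hs (b i) (b.ne_zero i) x
    exact ⟨d * c, by rw [hd, hsb, mul_smul]⟩
  choose t ht using hex
  have hsum : b 0 + b 1 + b 2 ≠ 0 := by
    intro h
    have := hrel (x := 1) (y := 1) (z := 1) (x' := 0) (y' := 0) (z' := 0) (by simpa using h)
    exact one_ne_zero this.1
  have htt (x : K) : t 0 x = t 1 x ∧ t 0 x = t 2 x := by
    obtain ⟨d, hd⟩ := hs _ hsum x
    rw [hc', smul_add, smul_add, map_add, map_add, ht, ht, ht] at hd
    have h : t 0 x • b 0 + t 1 x • b 1 + t 2 x • b 2 =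
        (d * c) • b 0 + (d * c) • b 1 + (d * c) • b 2 := by rw [hd]; module
    obtain ⟨h0, h1, h2⟩ := hrel h
    exact ⟨h0.trans h1.symm, h0.trans h2.symm⟩
  have hts (x : K) (i : Fin 3) : s (x • b i) = t 0 x • b i := by
    rw [ht]
    fin_cases i
    · rfl
    · simp [(htt x).1]
    · simp [(htt x).2]
  have hcancel (x y : K) (h : x • b 0 = y • b 0) : x = y :=
    smul_left_injective K (b.ne_zero 0) h
  have ht1 : t 0 1 = c := hcancel _ _ (by rw [← hts, one_smul, hsb])
  -- Multiplicativity comes from applying `s` to `x • (b 0 + y • b 1)`, whose image must be a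
  -- `K`-multiple of `c • b 0 + t 0 y • b 1`.
  have hmul (x y : K) : t 0 (x * y) * c = t 0 x * t 0 y := by
    have hne : b 0 + y • b 1 ≠ 0 := by
      intro h
      have := hrel (x := 1) (y := y) (z := 0) (x' := 0) (y' := 0) (z' := 0) (by simpa using h)
      exact one_ne_zero this.1
    obtain ⟨d, hd⟩ := hs _ hne x
    rw [smul_add, smul_smul, map_add, map_add, hts, hts, hts, hsb] at hd
    have h : t 0 x • b 0 + t 0 (x * y) • b 1 + (0 : K) • b 2 =
        (d * c) • b 0 + (d * t 0 y) • b 1 + (0 : K) • b 2 := by rw [zero_smul, add_zero, hd]; module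
    obtain ⟨h0, h1, -⟩ := hrel h
    rw [h0, h1]
    ring
  have hadd (x y : K) : t 0 (x + y) = t 0 x + t 0 y :=
    hcancel _ _ (by rw [← hts, add_smul, map_add, hts, hts, add_smul])
  have hF (a : F) : t 0 (algebraMap F K a) = algebraMap F K a * c :=
    hcancel _ _ (by rw [← hts, algebraMap_smul, map_smul, hsb, mul_smul, algebraMap_smul])
  -- Since `t 0 1 = c`, division by `c` normalizes `t 0` to a ring homomorphism.
  let θ : K →ₐ[F] K :=
    { toFun := fun x => t 0 x * c⁻¹
      map_one' := by rw [ht1, mul_inv_cancel₀ hc0]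
      map_mul' := fun x y => by
        have := hmul x y
        field_simp
        exact this
      map_zero' := by
        have := hadd 0 0
        simp only [add_zero, left_eq_add] at this
        rw [this, zero_mul]
      map_add' := fun x y => by rw [hadd, add_mul]
      commutes' := fun a => by rw [hF, mul_inv_cancel_right₀ hc0] }
  have hθ (x : K) : t 0 x = θ x * c := (inv_mul_cancel_right₀ hc0 (t 0 x)).symm
  refine ⟨θ, c, hsb, fun x v => ?_⟩
  rw [← b.sum_repr v, Finset.smul_sum, map_sum, map_sum, Finset.smul_sum]
  refine Finset.sum_congr rfl fun i _ => ?_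
  rw [smul_smul, hts, hts, smul_smul, hθ, hθ, map_mul, mul_assoc]

/-- A nontrivial automorphism of a cubic extension of finite fields has order three, and fixes
only the elements of the base field. -/
lemma algHom_cubic [Finite F] (hK : Module.finrank F K = 3) (θ : K →ₐ[F] K) (hθ : ∃ x, θ x ≠ x) :
    (∀ x, θ (θ (θ x)) = x) ∧ ∀ x, θ x = x → ∃ a : F, algebraMap F K a = x := by
  have : FiniteDimensional F K := Module.finite_of_finrank_pos (by omega)
  have : Finite K := Module.finite_of_finite F
  let τ : Gal(K/F) := AlgEquiv.ofBijective θ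
    ⟨θ.injective, Finite.surjective_of_injective θ.injective⟩
  have hτ (x : K) : τ x = θ x := rfl
  have hcard : Nat.card Gal(K/F) = 3 := by rw [IsGalois.card_aut_eq_finrank, hK]
  have : Fact (Nat.Prime 3) := ⟨Nat.prime_three⟩
  have hne : τ ≠ 1 := by
    obtain ⟨x, hx⟩ := hθ
    exact fun h => hx (by rw [← hτ, h]; rfl)
  constructor
  · intro x
    have h3 : τ ^ 3 = 1 := by rw [← hcard]; exact pow_card_eq_one'
    have h : τ (τ (τ x)) = x := by
      simpa [pow_succ] using congrArg (fun f : Gal(K/F) => f x) h3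
    exact h
  · intro x hx
    have hbot := (IsGalois.mem_bot_iff_fixed (F := F) x).2 fun f => by
      have hmem : f ∈ Subgroup.zpowers τ := mem_zpowers_of_prime_card hcard hne
      have hle : Subgroup.zpowers τ ≤ MulAction.stabilizer Gal(K/F) x := by
        rw [Subgroup.zpowers_le]
        exact hx
      exact hle hmem
    exact IntermediateField.mem_bot.1 hbot

end Semilinear

/-! ### Spans of orbits -/

section OrbitSpan

variable {F V : Type*} [Field F] [AddCommGroup V] [Module F V]

/-- The span of `v`, `s v` and `s (s v)`. -/
def orbitSpan (s : V ≃ₗ[F] V) (v : V) : Submodule F V :=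
  Submodule.span F (Set.range ![v, s v, s (s v)])

lemma mem_orbitSpan {s : V ≃ₗ[F] V} {v x : V} :
    x ∈ orbitSpan s v ↔ ∃ y : Fin 3 → F, y 0 • v + y 1 • s v + y 2 • s (s v) = x := by
  rw [orbitSpan, Submodule.mem_span_range_iff_exists_fun]
  simp [Fin.sum_univ_three]

lemma self_mem_orbitSpan (s : V ≃ₗ[F] V) (v : V) : v ∈ orbitSpan s v :=
  Submodule.subset_span ⟨0, rfl⟩

lemma orbitSpan_smul (s : V ≃ₗ[F] V) {a : F} (ha : a ≠ 0) (v : V) :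
    orbitSpan s (a • v) = orbitSpan s v := by
  ext x
  rw [mem_orbitSpan, mem_orbitSpan]
  constructor
  · rintro ⟨y, rfl⟩
    refine ⟨a • y, ?_⟩
    simp only [map_smul, Pi.smul_apply, smul_eq_mul]
    module
  · rintro ⟨y, rfl⟩
    refine ⟨a⁻¹ • y, ?_⟩
    simp only [map_smul, Pi.smul_apply, smul_eq_mul, smul_smul]
    field_simp

lemma orbitSpan_le {s : V ≃ₗ[F] V} {v : V} {W : Submodule F V} (hW : ∀ x ∈ W, s x ∈ W)
    (hv : v ∈ W) : orbitSpan s v ≤ W := by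
  rw [orbitSpan, Submodule.span_le]
  rintro _ ⟨i, rfl⟩
  fin_cases i
  · exact hv
  · exact hW _ hv
  · exact hW _ (hW _ hv)

lemma map_orbitSpan (s : V ≃ₗ[F] V) {d : F} (hd : ∀ v, s (s (s v)) = d • v) (v : V) :
    (orbitSpan s v).map s.toLinearMap = orbitSpan s v := by
  have hle : (orbitSpan s v).map s.toLinearMap ≤ orbitSpan s v := by
    rintro _ ⟨x, hx, rfl⟩
    obtain ⟨y, rfl⟩ := mem_orbitSpan.1 hx
    -- `s` shifts the coefficients cyclically, and `s³ = d` brings the last one back to `v`.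
    refine mem_orbitSpan.2 ⟨![d * y 2, y 0, y 1], ?_⟩
    simp only [LinearEquiv.coe_coe, map_add, map_smul, hd, Matrix.cons_val]
    module
  have : Module.Finite F (orbitSpan s v) := Module.Finite.span_of_finite F (Set.finite_range _)
  exact Submodule.eq_of_le_of_finrank_eq hle (LinearEquiv.finrank_map_eq s _)

lemma image_pointSet {σ : Equiv.Perm (ℙ F V)} {s : V ≃ₗ[F] V}
    (hs : ∀ P, σ P = Projectivization.map s.toLinearMap s.injective P) (W : Submodule F V) :
    σ '' pointSet W = pointSet (W.map s.toLinearMap) := by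
  ext P
  obtain ⟨P, rfl⟩ := σ.surjective P
  induction P using Projectivization.ind with
  | h v hv =>
    rw [σ.injective.mem_set_image, hs, Projectivization.map_mk, mk_mem_pointSet, mk_mem_pointSet]
    simp

end OrbitSpan

/-! ### The Segre structure on the orbit planes -/

section Orbit

variable {F K V : Type*} [Field F] [Field K] [Algebra F K]
  [AddCommGroup V] [Module K V] [Module F V] [IsScalarTower F K V]
  {s : V ≃ₗ[F] V} {θ : K →ₐ[F] K} {u : V}

lemma orbit_combination_smul (hs : ∀ (x : K) (v : V), s (x • v) = θ x • s v) (x : K)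
    (y : Fin 3 → F) :
    y 0 • x • u + y 1 • s (x • u) + y 2 • s (s (x • u)) =
      (y 0 • x) • u + (y 1 • θ x) • s u + (y 2 • θ (θ x)) • s (s u) := by
  simp only [hs, smul_assoc]

lemma linearIndependent_orbit_smul (hs : ∀ (x : K) (v : V), s (x • v) = θ x • s v)
    (hu : LinearIndependent K ![u, s u, s (s u)]) {x : K} (hx : x ≠ 0) :
    LinearIndependent F ![x • u, s (x • u), s (s (x • u))] := by
  rw [Fintype.linearIndependent_iff]
  intro y hy
  have hy' : y 0 • x • u + y 1 • s (x • u) + y 2 • s (s (x • u)) = 0 := by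
    simpa [Fin.sum_univ_three] using hy
  rw [orbit_combination_smul hs] at hy'
  obtain ⟨h0, h1, h2⟩ := coeff_eq_of_linearIndependent hu
    (x' := 0) (y' := 0) (z' := 0) (hy'.trans (by simp))
  intro i
  fin_cases i
  · simpa [hx] using h0
  · simpa [hx] using h1
  · simpa [hx] using h2

lemma finrank_orbitSpan_smul (hs : ∀ (x : K) (v : V), s (x • v) = θ x • s v)
    (hu : LinearIndependent K ![u, s u, s (s u)]) {x : K} (hx : x ≠ 0) :
    Module.finrank F (orbitSpan s (x • u)) = 3 := by
  rw [orbitSpan, finrank_span_eq_card (linearIndependent_orbit_smul hs hu hx), Fintype.card_fin]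

/-- Comparing coordinates along `u`, `s u`, `s² u` and cancelling powers of `θ` gives `y' i • x' = y
i • x` for each `i`; some `y i` is nonzero because `v` is. -/
lemma exists_smul_eq_of_mem_orbitSpan (hs : ∀ (x : K) (v : V), s (x • v) = θ x • s v)
    (hu : LinearIndependent K ![u, s u, s (s u)]) {x x' : K} {v : V} (hv : v ≠ 0)
    (h : v ∈ orbitSpan s (x • u)) (h' : v ∈ orbitSpan s (x' • u)) :
    ∃ a : F, a • x' = x := by
  obtain ⟨y, rfl⟩ := mem_orbitSpan.1 h
  obtain ⟨y', hy'⟩ := mem_orbitSpan.1 h'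
  rw [orbit_combination_smul hs, orbit_combination_smul hs] at hy'
  obtain ⟨h0, h1, h2⟩ := coeff_eq_of_linearIndependent hu hy'
  rw [← map_smul, ← map_smul] at h1
  rw [← map_smul, ← map_smul, ← map_smul, ← map_smul] at h2
  replace h1 := θ.injective h1
  replace h2 := θ.injective (θ.injective h2)
  have key (i : Fin 3) (hi : y' i • x' = y i • x) (hne : y i ≠ 0) : ∃ a : F, a • x' = x :=
    ⟨(y i)⁻¹ * y' i, by rw [mul_smul, hi, smul_smul, inv_mul_cancel₀ hne, one_smul]⟩
  by_contra hcon
  have hz (i : Fin 3) (hi : y' i • x' = y i • x) : y i = 0 := by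
    by_contra hne
    exact hcon (key i hi hne)
  apply hv
  rw [hz 0 h0, hz 1 h1, hz 2 h2]
  simp

/-- The coordinate of a combination along `s^j u` is `θ^j` of an `F`-combination of the `e i`, so
both independence hypotheses apply in turn. -/
lemma linearIndependent_smul_iterate {ι : Type*} [Fintype ι] (e : Module.Basis ι F K)
    (hs : ∀ (x : K) (v : V), s (x • v) = θ x • s v)
    (hu : LinearIndependent K ![u, s u, s (s u)]) :
    LinearIndependent F fun p : ι × Fin 3 =>
      ![e p.1 • u, s (e p.1 • u), s (s (e p.1 • u))] p.2 := by
  rw [Fintype.linearIndependent_iff]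
  intro g hg
  have hsum : (∑ i, g (i, 0) • e i) • u + θ (∑ i, g (i, 1) • e i) • s u +
      θ (θ (∑ i, g (i, 2) • e i)) • s (s u) = 0 := by
    rw [← hg, Fintype.sum_prod_type_right]
    simp [Fin.sum_univ_three, hs, map_sum, Finset.sum_smul]
  obtain ⟨h0, h1, h2⟩ := coeff_eq_of_linearIndependent hu
    (x' := 0) (y' := 0) (z' := 0) (hsum.trans (by simp))
  rw [map_eq_zero] at h1
  rw [map_eq_zero, map_eq_zero] at h2
  have he := Fintype.linearIndependent_iff.1 e.linearIndependent
  rintro ⟨i, j⟩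
  fin_cases j
  · exact he _ h0 i
  · exact he _ h1 i
  · exact he _ h2 i

/-- The planes spanned by the orbits of the points of a `K`-line form a ruling system of a Segre
variety. -/
lemma exists_basis_firstRulingSystem (hK : Module.finrank F K = 3)
    (hV : Module.finrank K V = 3) (hs : ∀ (x : K) (v : V), s (x • v) = θ x • s v)
    (hu : LinearIndependent K ![u, s u, s (s u)]) :
    ∃ b : Module.Basis (Fin 3 × Fin 3) F V,
      {π | ∃ x : K, x ≠ 0 ∧ π = pointSet (orbitSpan s (x • u))} = firstRulingSystem b := by
  have : FiniteDimensional F K := Module.finite_of_finrank_pos (by omega)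
  have : FiniteDimensional K V := Module.finite_of_finrank_pos (by omega)
  have : FiniteDimensional F V := Module.Finite.trans K V
  let e : Module.Basis (Fin 3) F K := Module.finBasisOfFinrankEq F K hK
  let b : Module.Basis (Fin 3 × Fin 3) F V :=
    basisOfLinearIndependentOfCardEqFinrank (linearIndependent_smul_iterate e hs hu) (by
      rw [← Module.finrank_mul_finrank F K V, hK, hV]; simp)
  have hvec (x y : Fin 3 → F) : segreVector b x y =
      y 0 • (∑ i, x i • e i) • u + y 1 • s ((∑ i, x i • e i) • u) +
        y 2 • s (s ((∑ i, x i • e i) • u)) := by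
    simp only [segreVector, b, coe_basisOfLinearIndependentOfCardEqFinrank]
    simp [Fin.sum_univ_three, hs, add_smul]
    module
  have hplane (x : Fin 3 → F) (hx : ∑ i, x i • e i ≠ 0) :
      {P : ℙ F V | ∃ y : Fin 3 → F, y ≠ 0 ∧
        P.submodule = Submodule.span F {segreVector b x y}} =
      pointSet (orbitSpan s ((∑ i, x i • e i) • u)) := by
    ext P
    induction P using Projectivization.ind with
    | h v hv =>
      rw [mk_mem_pointSet, Set.mem_ofPred_eq, Projectivization.submodule_mk]
      constructor
      · rintro ⟨y, -, hy⟩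
        rw [← Submodule.span_singleton_le_iff_mem, hy, Submodule.span_singleton_le_iff_mem,
          mem_orbitSpan]
        exact ⟨y, (hvec x y).symm⟩
      · intro h
        obtain ⟨y, hy⟩ := mem_orbitSpan.1 h
        refine ⟨y, ?_, by rw [hvec, hy]⟩
        rintro rfl
        exact hv (by simpa using hy.symm)
  refine ⟨b, Set.ext fun π => ⟨?_, ?_⟩⟩
  · rintro ⟨x, hx, rfl⟩
    have hsum : ∑ i, e.repr x i • e i = x := e.sum_repr x
    refine ⟨e.repr x, ?_, ?_⟩
    · simpa using hx
    · rw [hplane _ (by rwa [hsum]), hsum]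
  · rintro ⟨x, hx, rfl⟩
    have hne : ∑ i, x i • e i ≠ 0 := fun h =>
      hx (funext (Fintype.linearIndependent_iff.1 e.linearIndependent x h))
    exact ⟨_, hne, hplane x hne⟩

lemma ncard_orbitSpan_planes [Finite F] (hK : Module.finrank F K = 3)
    (hs : ∀ (x : K) (v : V), s (x • v) = θ x • s v)
    (hu : LinearIndependent K ![u, s u, s (s u)]) :
    {π | ∃ x : K, x ≠ 0 ∧ π = pointSet (orbitSpan s (x • u))}.ncard =
      Nat.card F ^ 2 + Nat.card F + 1 := by
  have hu0 : u ≠ 0 := hu.ne_zero 0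
  have hinj : Function.Injective fun P : ℙ F K => pointSet (orbitSpan s (P.rep • u)) := by
    intro P P' h
    obtain ⟨a, ha⟩ := exists_smul_eq_of_mem_orbitSpan hs hu
      (smul_ne_zero P.rep_nonzero hu0) (self_mem_orbitSpan s _)
      (pointSet_injective h ▸ self_mem_orbitSpan s (P.rep • u))
    rw [← P.mk_rep, ← P'.mk_rep, Projectivization.mk_eq_mk_iff']
    exact ⟨a, ha⟩
  have hrange : {π | ∃ x : K, x ≠ 0 ∧ π = pointSet (orbitSpan s (x • u))} =
      Set.range fun P : ℙ F K => pointSet (orbitSpan s (P.rep • u)) := by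
    ext π
    constructor
    · rintro ⟨x, hx, rfl⟩
      obtain ⟨a, ha⟩ := Projectivization.exists_smul_eq_mk_rep F x hx
      refine ⟨Projectivization.mk F x hx, ?_⟩
      have ha' : (Projectivization.mk F x hx).rep = (a : F) • x := ha.symm
      simp only [ha', smul_assoc]
      rw [orbitSpan_smul s a.ne_zero]
    · rintro ⟨P, rfl⟩
      exact ⟨P.rep, P.rep_nonzero, rfl⟩
  rw [hrange, Set.ncard_range_of_injective hinj, Projectivization.card_of_finrank F K hK]
  simp only [Finset.sum_range_succ, Finset.sum_range_zero]
  ring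

lemma pairwise_disjoint_orbitSpan_planes (hs : ∀ (x : K) (v : V), s (x • v) = θ x • s v)
    (hu : LinearIndependent K ![u, s u, s (s u)]) :
    {π | ∃ x : K, x ≠ 0 ∧ π = pointSet (orbitSpan s (x • u))}.Pairwise Disjoint := by
  rintro _ ⟨x, hx, rfl⟩ _ ⟨x', -, rfl⟩ hne
  rw [Set.disjoint_left]
  intro P
  induction P using Projectivization.ind with
  | h v hv =>
    rw [mk_mem_pointSet, mk_mem_pointSet]
    intro h h'
    obtain ⟨a, rfl⟩ := exists_smul_eq_of_mem_orbitSpan hs hu hv h h'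
    apply hne
    rw [smul_assoc, orbitSpan_smul]
    rintro rfl
    simp at hx

end Orbit

/-! ### From the collineation to the orbit planes -/

section Collineation

variable {F K V : Type*} [Field F] [Field K] [Algebra F K]
  [AddCommGroup V] [Module K V] [Module F V] [IsScalarTower F K V]
  {φ : Equiv.Perm (ℙ K V)} {σ : Equiv.Perm (ℙ F V)} {s : V ≃ₗ[F] V}

lemma mk_mem_spreadPlane {v u : V} (hv : v ≠ 0) (hu : u ≠ 0) :
    Projectivization.mk F v hv ∈ spreadPlane F (Projectivization.mk K u hu) ↔
      ∃ x : K, x • u = v := by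
  rw [spreadPlane, mk_mem_pointSet, Submodule.restrictScalars_mem, Projectivization.submodule_mk,
    Submodule.mem_span_singleton]

/-- The vector `s v` lies in the spread element of the image point, and any nonzero vector of a
spread element spans it over `K`. -/
lemma apply_mk_of_induces (hs : ∀ P, σ P = Projectivization.map s.toLinearMap s.injective P)
    (hσφ : Induces F φ σ) {v : V} (hv : v ≠ 0) :
    φ (Projectivization.mk K v hv) = Projectivization.mk K (s v) (by simpa using hv) := by
  have hmem : σ (Projectivization.mk F v hv) ∈ spreadPlane F (φ (Projectivization.mk K v hv)) := by
    rw [← hσφ]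
    exact Set.mem_image_of_mem _ ((mk_mem_spreadPlane hv hv).2 ⟨1, one_smul K v⟩)
  rw [hs, Projectivization.map_mk, ← (φ _).mk_rep, mk_mem_spreadPlane] at hmem
  obtain ⟨x, hx⟩ := hmem
  symm
  rw [← (φ _).mk_rep, Projectivization.mk_eq_mk_iff']
  exact ⟨x, hx⟩

lemma exists_smul_of_induces (hs : ∀ P, σ P = Projectivization.map s.toLinearMap s.injective P)
    (hσφ : Induces F φ σ) {v : V} (hv : v ≠ 0) (c : K) : ∃ d : K, s (c • v) = d • s v := by
  by_cases hc : c = 0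
  · exact ⟨0, by simp [hc]⟩
  have hcv : c • v ≠ 0 := smul_ne_zero hc hv
  have h : Projectivization.mk K (c • v) hcv = Projectivization.mk K v hv :=
    (Projectivization.mk_eq_mk_iff' ..).2 ⟨c, rfl⟩
  have h' := congrArg φ h
  rw [apply_mk_of_induces hs hσφ, apply_mk_of_induces hs hσφ,
    Projectivization.mk_eq_mk_iff'] at h'
  obtain ⟨d, hd⟩ := h'
  exact ⟨d, hd.symm⟩

lemma fixedIIIPlanesMeeting_eq {θ : K →ₐ[F] K} {u : V}
    (hsσ : ∀ P, σ P = Projectivization.map s.toLinearMap s.injective P)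
    (hs : ∀ (x : K) (v : V), s (x • v) = θ x • s v)
    {d : F} (hd : ∀ v, s (s (s v)) = d • v) (hu0 : u ≠ 0)
    (hu : LinearIndependent K ![u, s u, s (s u)])
    (hIII : IsTypeIII φ (Projectivization.mk K u hu0)) :
    fixedIIIPlanesMeeting F φ σ (spreadPlane F (Projectivization.mk K u hu0)) =
      {π | ∃ x : K, x ≠ 0 ∧ π = pointSet (orbitSpan s (x • u))} := by
  ext π
  constructor
  · rintro ⟨⟨⟨W, hW, rfl⟩, hfix, -⟩, R, hRπ, hRγ⟩
    induction R using Projectivization.ind with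
    | h v hv =>
      rw [mk_mem_spreadPlane] at hRγ
      obtain ⟨x, rfl⟩ := hRγ
      have hx : x ≠ 0 := by
        rintro rfl
        simp at hv
      rw [mk_mem_pointSet] at hRπ
      rw [image_pointSet hsσ] at hfix
      have hle : orbitSpan s (x • u) ≤ W := orbitSpan_le (fun y hy => by
        rw [← pointSet_injective hfix]
        exact Submodule.mem_map_of_mem hy) hRπ
      have : Module.Finite F W := Module.finite_of_finrank_pos (by omega)
      refine ⟨x, hx, ?_⟩
      rw [Submodule.eq_of_le_of_finrank_eq hle]
      rw [hW, finrank_orbitSpan_smul hs hu hx]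
  · rintro ⟨x, hx, rfl⟩
    have hxu : x • u ≠ 0 := smul_ne_zero hx hu0
    have hmem := (mk_mem_spreadPlane (F := F) hxu hu0).2 ⟨x, rfl⟩
    have hmem' := (mk_mem_pointSet hxu).2 (self_mem_orbitSpan s (x • u))
    refine ⟨⟨⟨_, finrank_orbitSpan_smul hs hu hx, rfl⟩, ?_, _, hmem', ⟨_, ⟨_, hIII, rfl⟩, hmem⟩, ?_⟩,
      _, hmem', hmem⟩
    · rw [image_pointSet hsσ, map_orbitSpan s hd]
    · simp only [hsσ, Projectivization.map_mk]
      exact not_areCollinear_of_linearIndependent _ _ _ (linearIndependent_orbit_smul hs hu hx)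

lemma exists_semilinear_of_induces [Finite F] (hK : Module.finrank F K = 3)
    (hs : ∀ P, σ P = Projectivization.map s.toLinearMap s.injective P) (hσφ : Induces F φ σ)
    (hφ : φ ≠ 1) (hfix : ∃ B : Set (ℙ K V), IsSubplane F B ∧ ∀ P ∈ B, φ P = P) :
    ∃ θ : K →ₐ[F] K, (∀ (x : K) (v : V), s (x • v) = θ x • s v) ∧
      ∃ d : F, ∀ v, s (s (s v)) = d • v := by
  obtain ⟨_, ⟨b, rfl⟩, hB⟩ := hfix
  have hb (a : Fin 3 → F) (ha : a ≠ 0) : ∃ c : K, s (∑ i, a i • b i) = c • ∑ i, a i • b i := by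
    have hne : ∑ i, a i • b i ≠ 0 := fun h => by
      have hli : LinearIndependent F b := b.linearIndependent.restrict_scalars (by
        intro x y hxy
        simpa [← Algebra.algebraMap_eq_smul_one] using hxy)
      exact ha (funext (Fintype.linearIndependent_iff.1 hli a h))
    have h := hB (Projectivization.mk K _ hne) ⟨a, ha, Projectivization.submodule_mk ..⟩
    rw [apply_mk_of_induces hs hσφ, Projectivization.mk_eq_mk_iff'] at h
    obtain ⟨c, hc⟩ := h
    exact ⟨c, hc.symm⟩
  obtain ⟨θ, c, hsb, hsθ⟩ := exists_algHom_of_fixes_subplane b s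
    (fun v hv x => exists_smul_of_induces hs hσφ hv x) hb
  refine ⟨θ, hsθ, ?_⟩
  have hθ : ∃ x, θ x ≠ x := by
    -- With `θ` trivial, `s` would be multiplication by `c`, and `φ` the identity.
    by_contra! hθ
    have hsc (v : V) : s v = c • v := by
      rw [← b.sum_repr v, map_sum, Finset.smul_sum]
      exact Finset.sum_congr rfl fun i _ => by rw [hsθ, hθ, hsb, smul_comm]
    apply hφ
    ext P
    induction P using Projectivization.ind with
    | h v hv =>
      rw [apply_mk_of_induces hs hσφ, Equiv.Perm.one_apply, Projectivization.mk_eq_mk_iff']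
      exact ⟨c, (hsc v).symm⟩
  obtain ⟨h3, hF⟩ := algHom_cubic hK θ hθ
  -- Each `b i` is multiplied by `θ²(c) θ(c) c` under `s³`; this norm of `c` is fixed by `θ`, hence
  -- lies in `F`.
  obtain ⟨d, hd⟩ := hF (θ (θ c) * (θ c * c)) (by
    rw [map_mul, map_mul, h3]
    ring)
  refine ⟨d, fun v => ?_⟩
  rw [← algebraMap_smul K d, hd, ← b.sum_repr v, Finset.smul_sum]
  simp only [map_sum]
  refine Finset.sum_congr rfl fun i _ => ?_
  simp only [hsθ, hsb, h3, smul_smul, map_mul]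
  congr 1
  ring

end Collineation

end FieldReduction

theorem theorem21 {F K V : Type*} [Field F] [Finite F] [Field K] [Algebra F K]
    [AddCommGroup V] [Module K V] [Module F V] [IsScalarTower F K V]
    (hq : 2 < Nat.card F) (hK : Module.finrank F K = 3) (hV : Module.finrank K V = 3)
    (φ : Equiv.Perm (ℙ K V)) (hφ : FieldReduction.IsCollineation φ) (hφ3 : orderOf φ = 3)
    (hfix : ∃ B : Set (ℙ K V), FieldReduction.IsSubplane F B ∧ ∀ P ∈ B, φ P = P)
    (σ : Equiv.Perm (ℙ F V)) (hσ : FieldReduction.IsProjectivity σ)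
    (hσφ : FieldReduction.Induces F φ σ)
    (γ : Set (ℙ F V)) (hγ : FieldReduction.IsSpreadIIIPlane F φ γ) :
    (FieldReduction.fixedIIIPlanesMeeting F φ σ γ).ncard = Nat.card F ^ 2 + Nat.card F + 1 ∧
    (FieldReduction.fixedIIIPlanesMeeting F φ σ γ).Pairwise Disjoint ∧
    ∃ 𝒮 : Set (ℙ F V),
      FieldReduction.IsRulingSystemOfSegre 𝒮 (FieldReduction.fixedIIIPlanesMeeting F φ σ γ) := by
  obtain ⟨s, hs⟩ := hσ
  have hne : φ ≠ 1 := by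
    rintro rfl
    simp at hφ3
  obtain ⟨θ, hsθ, d, hd⟩ := FieldReduction.exists_semilinear_of_induces hK hs hσφ hne hfix
  obtain ⟨P, hP, rfl⟩ := hγ
  induction P using Projectivization.ind with
  | h u hu0 =>
    have hu : LinearIndependent K ![u, s u, s (s u)] := by
      have h := hP
      simp only [FieldReduction.IsTypeIII, FieldReduction.apply_mk_of_induces hs hσφ] at h
      exact FieldReduction.linearIndependent_of_not_areCollinear hV _ _ _ h
    rw [FieldReduction.fixedIIIPlanesMeeting_eq hs hsθ hd hu0 hu hP]
    obtain ⟨b, hb⟩ := FieldReduction.exists_basis_firstRulingSystem hK hV hsθ hu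
    exact ⟨FieldReduction.ncard_orbitSpan_planes hK hsθ hu,
      FieldReduction.pairwise_disjoint_orbitSpan_planes hsθ hu, _, b, rfl, Or.inl hb⟩
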